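/- Let $n\ge 1$ and let $S=(s_{i,j})_{i,j=1}^n$ be a real symmetric matrix with non-negative entries such that $s_{i,j}>0$ whenever $i+j=n$ or $i+j=n+1$, and $s_{i,j}=0$ whenever $i+j\ge n+2$. Let $\mathbb H=\{z\in\mathbb C:\operatorname{Im}z>0\}$. Then there is a unique function $m=(m_1,\dots,m_n):\mathbb H\to\mathbb H^n$ solving the vector Dyson equation $$-\frac{1}{m_k(z)}=z+\sum_{j=1}^n s_{k,j}\,m_j(z)\qquad (z\in\mathbb H,\ k=1,\dots,n).$$ For this $m$ and for all sufficiently small real $E\ne 0$, the limit defining the self-consistent density of states, $$\rho(E)=\lim_{\eta\downarrow 0}\frac{1}{\pi n}\sum_{k=1}^n\operatorname{Im}m_k(E+i\eta),$$ exists and is finite. Moreover the (two-sided) limit $$\lim_{E\to 0}\rho(E)\,|E|^{\frac{n-1}{n+1}}$$ exists, is finite, and is strictly positive. -/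

import Mathlib

open Filter Topology
open scoped UpperHalfPlane

/-- The variance matrix of the model: real symmetric with non-negative entries, strictly positive
on and right above the anti-diagonal, and zero below the anti-diagonal. The 1-based row and column
indices of the entry `S i j` are `i + 1` and `j + 1`. -/
structure IsStaircase {n : ℕ} (S : Matrix (Fin n) (Fin n) ℝ) : Prop where
  symm : S.IsSymm
  nonneg : ∀ i j, 0 ≤ S i j
  pos_above : ∀ i j : Fin n, ((i : ℕ) + 1) + ((j : ℕ) + 1) = n → 0 < S i j
  pos_anti : ∀ i j : Fin n, ((i : ℕ) + 1) + ((j : ℕ) + 1) = n + 1 → 0 < S i j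
  zero_below : ∀ i j : Fin n, n + 2 ≤ ((i : ℕ) + 1) + ((j : ℕ) + 1) → S i j = 0

/-- `m : ℍ → ℍⁿ` solves the vector Dyson equation `-1/m = z + S m` on the upper half-plane. -/
def IsVDESolution {n : ℕ} (S : Matrix (Fin n) (Fin n) ℝ) (m : ℍ → Fin n → ℍ) : Prop :=
  ∀ (z : ℍ) (k : Fin n), -1 / (m z k : ℂ) = (z : ℂ) + ∑ j, (S k j : ℂ) * (m z j : ℂ)

/-- `(1 / (π n)) ∑ₖ Im mₖ(E + iη)`. For `η > 0` the point `E + iη` lies in the upper half-plane and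
`UpperHalfPlane.ofComplex` returns this point; values at `η ≤ 0` are never used. -/
noncomputable def smoothedDOS {n : ℕ} (m : ℍ → Fin n → ℍ) (E η : ℝ) : ℝ :=
  1 / (Real.pi * n) * ∑ k, (m (UpperHalfPlane.ofComplex (E + η * Complex.I)) k).im

/-- The self-consistent density of states `ρ(E)`, the limit of `smoothedDOS m E η` as `η ↓ 0`. -/
noncomputable def selfConsistentDOS {n : ℕ} (m : ℍ → Fin n → ℍ) (E : ℝ) : ℝ :=
  limUnder (𝓝[>] (0 : ℝ)) (fun η : ℝ => smoothedDOS m E η)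

/-!
# Density of states at the singularity of a staircase variance profile

For fixed `z` the map `a ↦ -1 / (z + S a)` of `ℍⁿ` satisfies a quantitative Schwarz–Pick estimate
(`dist_dysonMap_le`): measured by `|a - b| / √(Im a Im b)` it contracts, uniformly on its own range.
Hence the vector Dyson equation has exactly one solution for each `z`, and it suffices to exhibit
*some* solution in `ℍⁿ` near `z = 0`.

With `η = -I z`, 1-based indices and `t = η ^ (2 / (n + 1))`, the substitution
`m k = I η t⁻ᵏ u k` turns the equation into a system that is polynomial in `t` and `u`
(`rescaledEq`). At `t = 0` this reads `s k (n + 1 - k) u k u (n + 1 - k) = 1`, which is degenerate: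
the equations `k` and `n + 1 - k` coincide. Their difference is divisible by `t`, and replacing it
by its quotient by `t` gives an equivalent system (`desingularizedEq`) which has a positive solution
at `t = 0` (`exists_leading_coefficients`) and an invertible linearisation there
(`linearized_kernel_trivial`). The implicit function theorem gives a solution `u t` continuous near
`t = 0`. The exponents `1 - 2 k / (n + 1)` of `η` lie strictly between `-1` and `1`, so for small `z`
the resulting `m` does lie in `ℍⁿ` and is the solution (`exists_local_solution`).

This formula extends continuously to real `z = E ≠ 0`. As `E → 0` the entry `k = n`, of size
`|E| ^ (-(n - 1) / (n + 1))`, dominates, and the limit is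
`v n * cos (π (n - 1) / (2 (n + 1))) / (π n)` with `v = u 0`.
-/

/-! ### The vector Dyson equation at a fixed spectral parameter -/

section DysonMap

variable {ι : Type*} [Fintype ι]

theorem dyson_im_pos {S : Matrix ι ι ℝ} (hS : ∀ i j, 0 ≤ S i j) (z : ℍ) {a : ι → ℂ}
    (ha : ∀ j, 0 ≤ (a j).im) (k : ι) : 0 < ((z : ℂ) + ∑ j, (S k j : ℂ) * a j).im := by
  have h : 0 ≤ ∑ j, S k j * (a j).im :=
    Finset.sum_nonneg fun j _ => mul_nonneg (hS k j) (ha j)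
  simp only [Complex.add_im, Complex.im_sum, Complex.im_ofReal_mul]
  exact add_pos_of_pos_of_nonneg z.im_pos h

theorem neg_one_div_im (w : ℂ) : (-1 / w).im = w.im / ‖w‖ ^ 2 := by
  rw [neg_div, one_div, Complex.neg_im, Complex.inv_im, Complex.normSq_eq_norm_sq]
  ring

/-- The right-hand side of the vector Dyson equation in fixed point form,
`a ↦ -1 / (z + S a)`, as a self-map of `ℍ^ι`. -/
noncomputable def dysonMap (S : Matrix ι ι ℝ) (hS : ∀ i j, 0 ≤ S i j) (z : ℍ) (a : ι → ℍ) :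
    ι → ℍ := fun k =>
  ⟨-1 / ((z : ℂ) + ∑ j, (S k j : ℂ) * (a j : ℂ)), by
    have h := dyson_im_pos hS z (a := fun j => (a j : ℂ)) (fun j => (a j).im_pos.le) k
    rw [neg_one_div_im]
    have hw : (z : ℂ) + ∑ j, (S k j : ℂ) * (a j : ℂ) ≠ 0 := fun h0 => by
      simp [h0] at h
    positivity⟩

variable {S : Matrix ι ι ℝ} (hS : ∀ i j, 0 ≤ S i j)

theorem coe_dysonMap (z : ℍ) (a : ι → ℍ) (k : ι) :
    (dysonMap S hS z a k : ℂ) = -1 / ((z : ℂ) + ∑ j, (S k j : ℂ) * (a j : ℂ)) := rfl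

theorem dysonMap_eq_self_iff {z : ℍ} {a : ι → ℍ} : dysonMap S hS z a = a ↔
    ∀ k, -1 / (a k : ℂ) = (z : ℂ) + ∑ j, (S k j : ℂ) * (a j : ℂ) := by
  have key : ∀ x y : ℂ, -1 / x = y ↔ -1 / y = x := fun x y => by
    constructor <;> rintro rfl <;> simp [neg_div]
  rw [funext_iff]
  refine forall_congr' fun k => ?_
  rw [← UpperHalfPlane.coe_inj, coe_dysonMap, key]

theorem norm_dysonMap_le (z : ℍ) (a : ι → ℍ) (k : ι) :
    ‖(dysonMap S hS z a k : ℂ)‖ ≤ 1 / z.im := by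
  have h : z.im ≤ ((z : ℂ) + ∑ j, (S k j : ℂ) * (a j : ℂ)).im := by
    simp only [Complex.add_im, Complex.im_sum, Complex.im_ofReal_mul, UpperHalfPlane.coe_im]
    exact le_add_of_nonneg_right
      (Finset.sum_nonneg fun j _ => mul_nonneg (hS k j) (a j).im_pos.le)
  rw [coe_dysonMap, norm_div, norm_neg, norm_one]
  exact one_div_le_one_div_of_le z.im_pos
    (h.trans ((le_abs_self _).trans (Complex.abs_im_le_norm _)))

/-- `|a - b| / √(Im a Im b)` is an increasing function of the hyperbolic distance of `a` and `b`,
so this is a quantitative form of the Schwarz–Pick lemma for the map `a ↦ -1 / (z + S a)`: the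
shift by `z` makes it a strict contraction. -/
theorem dist_dysonMap_le (z : ℍ) (a b : ι → ℍ) {D M : ℝ} (hD : 0 ≤ D)
    (hab : ∀ k, ‖(a k : ℂ) - b k‖ ≤ D * (√(a k).im * √(b k).im)) (k : ι)
    (haM : z.im + ∑ j, S k j * (a j).im ≤ M) (hbM : z.im + ∑ j, S k j * (b j).im ≤ M) :
    ‖(dysonMap S hS z a k : ℂ) - dysonMap S hS z b k‖ ≤
      D * (1 - z.im / M) * (√(dysonMap S hS z a k).im * √(dysonMap S hS z b k).im) := by
  have him : ∀ c : ι → ℍ, ((z : ℂ) + ∑ j, (S k j : ℂ) * (c j : ℂ)).im =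
      z.im + ∑ j, S k j * (c j).im := fun c => by
    simp
  have hpos : ∀ c : ι → ℍ, 0 < z.im + ∑ j, S k j * (c j).im := fun c =>
    add_pos_of_pos_of_nonneg z.im_pos
      (Finset.sum_nonneg fun j _ => mul_nonneg (hS k j) (c j).im_pos.le)
  have hne : ∀ c : ι → ℍ, (z : ℂ) + ∑ j, (S k j : ℂ) * (c j : ℂ) ≠ 0 := fun c h0 => by
    have := hpos c
    rw [← him, h0] at this
    simp at this
  have hsq : ∀ c : ι → ℍ, √(dysonMap S hS z c k).im =
      √(z.im + ∑ j, S k j * (c j).im) / ‖(z : ℂ) + ∑ j, (S k j : ℂ) * (c j : ℂ)‖ := fun c => by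
    rw [← UpperHalfPlane.coe_im, coe_dysonMap, neg_one_div_im, him,
      Real.sqrt_div' _ (sq_nonneg _), Real.sqrt_sq (norm_nonneg _)]
  rw [hsq, hsq, coe_dysonMap, coe_dysonMap]
  have hα := hne a
  have hβ := hne b
  have hA := hpos a
  have hB := hpos b
  have hdiff : ‖((z : ℂ) + ∑ j, (S k j : ℂ) * (a j : ℂ)) - (z + ∑ j, (S k j : ℂ) * (b j : ℂ))‖ ≤
      D * (√(∑ j, S k j * (a j).im) * √(∑ j, S k j * (b j).im)) := by
    rw [add_sub_add_left_eq_sub, ← Finset.sum_sub_distrib]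
    calc _ ≤ ∑ j, ‖(S k j : ℂ) * (a j : ℂ) - (S k j : ℂ) * (b j : ℂ)‖ := norm_sum_le _ _
      _ ≤ ∑ j, D * (√(S k j * (a j).im) * √(S k j * (b j).im)) := by
          refine Finset.sum_le_sum fun j _ => ?_
          rw [← mul_sub, norm_mul, Complex.norm_real, Real.norm_of_nonneg (hS k j),
            Real.sqrt_mul (hS k j), Real.sqrt_mul (hS k j)]
          calc _ ≤ S k j * (D * (√(a j).im * √(b j).im)) :=
                mul_le_mul_of_nonneg_left (hab j) (hS k j)
            _ = D * ((√(S k j) * √(S k j)) * (√(a j).im * √(b j).im)) := by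
                rw [Real.mul_self_sqrt (hS k j)]; ring
            _ = _ := by ring
      _ ≤ _ := by
          rw [← Finset.mul_sum]
          exact mul_le_mul_of_nonneg_left (Real.sum_sqrt_mul_sqrt_le _
            (fun j => mul_nonneg (hS k j) (a j).im_pos.le)
            (fun j => mul_nonneg (hS k j) (b j).im_pos.le)) hD
  generalize (z : ℂ) + ∑ j, (S k j : ℂ) * (a j : ℂ) = α at *
  generalize (z : ℂ) + ∑ j, (S k j : ℂ) * (b j : ℂ) = β at *
  have hX : 0 ≤ ∑ j, S k j * (a j).im :=
    Finset.sum_nonneg fun j _ => mul_nonneg (hS k j) (a j).im_pos.le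
  have hY : 0 ≤ ∑ j, S k j * (b j).im :=
    Finset.sum_nonneg fun j _ => mul_nonneg (hS k j) (b j).im_pos.le
  generalize ∑ j, S k j * (a j).im = X at *
  generalize ∑ j, S k j * (b j).im = Y at *
  have hz := z.im_pos
  generalize z.im = η at *
  have hM : 0 < M := hA.trans_le haM
  -- Cauchy–Schwarz for the vectors `(√X, √η)` and `(√Y, √η)`.
  have hcs : √X * √Y ≤ √(η + X) * √(η + Y) - η := by
    rw [le_sub_iff_add_le, ← Real.sqrt_mul hA.le]
    apply Real.le_sqrt_of_sq_le
    nlinarith [Real.sq_sqrt hX, Real.sq_sqrt hY, sq_nonneg (√X - √Y)]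
  have hle : √(η + X) * √(η + Y) ≤ M := by
    rw [← Real.sqrt_mul hA.le]
    apply Real.sqrt_le_iff.2 ⟨hM.le, _⟩
    nlinarith
  have hfin : √X * √Y ≤ (1 - η / M) * (√(η + X) * √(η + Y)) := by
    refine hcs.trans ?_
    have : η / M * (√(η + X) * √(η + Y)) ≤ η := by
      rw [div_mul_eq_mul_div, div_le_iff₀ hM]
      exact mul_le_mul_of_nonneg_left hle hz.le
    linarith
  have hα' := norm_pos_iff.2 hα
  have hβ' := norm_pos_iff.2 hβ
  have e : -1 / α - -1 / β = (α - β) / (α * β) := by field_simp; ring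
  rw [e, norm_div, norm_mul, div_le_iff₀ (by positivity)]
  calc _ ≤ D * (√X * √Y) := hdiff
    _ ≤ D * ((1 - η / M) * (√(η + X) * √(η + Y))) := mul_le_mul_of_nonneg_left hfin hD
    _ = _ := by field_simp

/-- On the range of `dysonMap` the contraction factor of `dist_dysonMap_le` is uniform. -/
theorem exists_dysonMap_contraction (z : ℍ) : ∃ q : ℝ, 0 ≤ q ∧ q < 1 ∧
    ∀ (a b : ι → ℍ) (D : ℝ), 0 ≤ D → (∀ k, ‖(a k : ℂ)‖ ≤ 1 / z.im) →
    (∀ k, ‖(b k : ℂ)‖ ≤ 1 / z.im) →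
    (∀ k, ‖(a k : ℂ) - b k‖ ≤ D * (√(a k).im * √(b k).im)) →
    ∀ k, ‖(dysonMap S hS z a k : ℂ) - dysonMap S hS z b k‖ ≤
      D * q * (√(dysonMap S hS z a k).im * √(dysonMap S hS z b k).im) := by
  have hz := z.im_pos
  have hs : 0 ≤ ∑ i, ∑ j, S i j * (1 / z.im) :=
    Finset.sum_nonneg fun i _ => Finset.sum_nonneg fun j _ =>
      mul_nonneg (hS i j) (by positivity)
  set M := z.im + ∑ i, ∑ j, S i j * (1 / z.im) with hM
  have hMz : z.im ≤ M := by linarith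
  have hM0 : 0 < M := hz.trans_le hMz
  have bound : ∀ c : ι → ℍ, (∀ k, ‖(c k : ℂ)‖ ≤ 1 / z.im) → ∀ k,
      z.im + ∑ j, S k j * (c j).im ≤ M := fun c hc k => by
    rw [hM]
    refine add_le_add_right ?_ _
    calc ∑ j, S k j * (c j).im ≤ ∑ j, S k j * (1 / z.im) :=
          Finset.sum_le_sum fun j _ => mul_le_mul_of_nonneg_left
            (((le_abs_self _).trans (Complex.abs_im_le_norm (c j : ℂ))).trans (hc j)) (hS k j)
      _ ≤ _ := Finset.single_le_sum (f := fun i => ∑ j, S i j * (1 / z.im))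
          (fun i _ => Finset.sum_nonneg fun j _ => mul_nonneg (hS i j) (by positivity))
          (Finset.mem_univ k)
  refine ⟨1 - z.im / M, ?_, ?_, fun a b D hD ha hb hab k =>
    dist_dysonMap_le hS z a b hD hab k (bound a ha k) (bound b hb k)⟩
  · rw [sub_nonneg]; exact (div_le_one hM0).2 hMz
  · have : 0 < z.im / M := by positivity
    linarith

theorem exists_hyperbolic_bound (a b : ι → ℍ) : ∃ D : ℝ, 0 ≤ D ∧
    ∀ k, ‖(a k : ℂ) - b k‖ ≤ D * (√(a k).im * √(b k).im) := by
  have h0 : ∀ k, 0 < √(a k).im * √(b k).im := fun k =>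
    mul_pos (Real.sqrt_pos.2 (a k).im_pos) (Real.sqrt_pos.2 (b k).im_pos)
  have h1 : ∀ k, 0 ≤ ‖(a k : ℂ) - b k‖ / (√(a k).im * √(b k).im) := fun k =>
    div_nonneg (norm_nonneg _) (h0 k).le
  refine ⟨∑ k, ‖(a k : ℂ) - b k‖ / (√(a k).im * √(b k).im),
    Finset.sum_nonneg fun k _ => h1 k, fun k => ?_⟩
  rw [← div_le_iff₀ (h0 k)]
  exact Finset.single_le_sum (fun k _ => h1 k) (Finset.mem_univ k)

theorem sqrt_im_mul_sqrt_im_le {a b : ℍ} {r : ℝ} (ha : ‖(a : ℂ)‖ ≤ r) (hb : ‖(b : ℂ)‖ ≤ r) :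
    √a.im * √b.im ≤ r := by
  have hr : 0 ≤ r := (norm_nonneg _).trans ha
  have h : ∀ c : ℍ, ‖(c : ℂ)‖ ≤ r → √c.im ≤ √r := fun c hc =>
    Real.sqrt_le_sqrt (((le_abs_self _).trans (Complex.abs_im_le_norm (c : ℂ))).trans hc)
  calc √a.im * √b.im ≤ √r * √r := mul_le_mul (h a ha) (h b hb) (Real.sqrt_nonneg _)
        (Real.sqrt_nonneg _)
    _ = r := Real.mul_self_sqrt hr

/-- Iterating the contraction shows that differences of iterates decay geometrically. -/
theorem exists_norm_iterate_dysonMap_sub_le (z : ℍ) (a b : ι → ℍ) : ∃ C q : ℝ, q < 1 ∧ 0 ≤ q ∧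
    ∀ (p : ℕ) (k : ι), ‖((dysonMap S hS z)^[p] (dysonMap S hS z a) k : ℂ) -
      (dysonMap S hS z)^[p] (dysonMap S hS z b) k‖ ≤ C * q ^ p := by
  obtain ⟨q, hq0, hq1, hq⟩ := exists_dysonMap_contraction hS z
  obtain ⟨D, hD0, hD⟩ := exists_hyperbolic_bound (dysonMap S hS z a) (dysonMap S hS z b)
  have hbd : ∀ (c : ι → ℍ) (p : ℕ) (k : ι),
      ‖((dysonMap S hS z)^[p] (dysonMap S hS z c) k : ℂ)‖ ≤ 1 / z.im := fun c p k => by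
    rw [← Function.iterate_succ_apply, Function.iterate_succ_apply']
    exact norm_dysonMap_le hS z _ k
  have main : ∀ (p : ℕ) (k : ι), ‖((dysonMap S hS z)^[p] (dysonMap S hS z a) k : ℂ) -
      (dysonMap S hS z)^[p] (dysonMap S hS z b) k‖ ≤
      D * q ^ p * (√((dysonMap S hS z)^[p] (dysonMap S hS z a) k).im *
        √((dysonMap S hS z)^[p] (dysonMap S hS z b) k).im) := by
    intro p
    induction p with
    | zero => simpa using hD
    | succ p ih =>
      intro k
      rw [Function.iterate_succ_apply', Function.iterate_succ_apply', pow_succ,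
        ← mul_assoc D]
      exact hq _ _ _ (by positivity) (hbd a p) (hbd b p) ih k
  refine ⟨D * (1 / z.im), q, hq1, hq0, fun p k => (main p k).trans ?_⟩
  calc _ ≤ D * q ^ p * (1 / z.im) := mul_le_mul_of_nonneg_left
        (sqrt_im_mul_sqrt_im_le (hbd a p k) (hbd b p k)) (by positivity)
    _ = _ := by ring

theorem dysonMap_fixedPoint_unique (z : ℍ) {a b : ι → ℍ} (ha : dysonMap S hS z a = a)
    (hb : dysonMap S hS z b = b) : a = b := by
  obtain ⟨C, q, hq1, hq0, h⟩ := exists_norm_iterate_dysonMap_sub_le hS z a b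
  rw [ha, hb] at h
  funext k
  have h0 : Tendsto (fun p : ℕ => C * q ^ p) atTop (𝓝 0) := by
    simpa using (tendsto_pow_atTop_nhds_zero_of_lt_one hq0 hq1).const_mul C
  have : ‖(a k : ℂ) - b k‖ ≤ 0 := ge_of_tendsto' h0 fun p => by
    simpa only [Function.iterate_fixed ha, Function.iterate_fixed hb] using h p k
  exact UpperHalfPlane.ext (sub_eq_zero.1 (norm_le_zero_iff.1 this))

theorem exists_dysonMap_fixedPoint (z : ℍ) : ∃ a : ι → ℍ, dysonMap S hS z a = a := by
  set F := dysonMap S hS z with hF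
  let x : ℕ → ι → ℍ := fun p => F^[p] (F fun _ => UpperHalfPlane.I)
  obtain ⟨C, q, hq1, hq0, h⟩ := exists_norm_iterate_dysonMap_sub_le hS z
    (fun _ => UpperHalfPlane.I) (F fun _ => UpperHalfPlane.I)
  have hx : ∀ p, x (p + 1) = F (x p) := fun p => Function.iterate_succ_apply' _ _ _
  have hlim : ∀ k, ∃ w : ℂ, Tendsto (fun p => (x p k : ℂ)) atTop (𝓝 w) := fun k => by
    refine cauchySeq_tendsto_of_complete (cauchySeq_of_le_geometric q C hq1 fun p => ?_)
    rw [dist_eq_norm]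
    exact h p k
  choose w hw using hlim
  have hwim : ∀ k, 0 ≤ (w k).im := fun k =>
    ge_of_tendsto' ((Complex.continuous_im.tendsto _).comp (hw k)) fun p => (x p k).im_pos.le
  -- The limit is a priori only in the closed half-plane, but the right-hand side of the fixed
  -- point equation has imaginary part at least `Im z`, which puts its image back into `ℍ`.
  have hden : ∀ k, (z : ℂ) + ∑ j, (S k j : ℂ) * w j ≠ 0 := fun k h0 => by
    have := dyson_im_pos hS z hwim k
    simp [h0] at this
  have heq : ∀ k, w k = -1 / ((z : ℂ) + ∑ j, (S k j : ℂ) * w j) := fun k => by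
    refine tendsto_nhds_unique ((tendsto_add_atTop_iff_nat 1).2 (hw k)) ?_
    have : (fun p => (x (p + 1) k : ℂ)) =
        fun p => -1 / ((z : ℂ) + ∑ j, (S k j : ℂ) * (x p j : ℂ)) := by
      funext p
      rw [hx]
      rfl
    rw [this]
    exact tendsto_const_nhds.div (tendsto_const_nhds.add
      (tendsto_finsetSum _ fun j _ => (hw j).const_mul _)) (hden k)
  have hpos : ∀ k, 0 < (w k).im := fun k => by
    have h1 := dyson_im_pos hS z hwim k
    have h2 := norm_pos_iff.2 (hden k)
    rw [heq k, neg_one_div_im]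
    positivity
  refine ⟨fun k => ⟨w k, hpos k⟩, funext fun k => UpperHalfPlane.ext ?_⟩
  exact (heq k).symm

end DysonMap

theorem existsUnique_isVDESolution {n : ℕ} {S : Matrix (Fin n) (Fin n) ℝ}
    (hS : ∀ i j, 0 ≤ S i j) : ∃! m : ℍ → Fin n → ℍ, IsVDESolution S m := by
  choose m hm using exists_dysonMap_fixedPoint hS
  refine ⟨m, fun z => (dysonMap_eq_self_iff hS).1 (hm z), fun m' hm' => funext fun z => ?_⟩
  exact dysonMap_fixedPoint_unique hS z ((dysonMap_eq_self_iff hS).2 (hm' z)) (hm z)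

/-! ### The leading-order system -/

section LeadingOrder

variable {n : ℕ} {s : ℕ → ℕ → ℝ}

/-- The coefficients of the leading-order solution. The condition on `s k (n + 1 - k)` is the
leading-order equation; for `n ≥ 2` it leaves some `v k` free. The condition on `s k (n - k)` is the
solvability condition of the next order. Together they determine `v`. -/
theorem exists_leading_coefficients (hsymm : ∀ k j, s k j = s j k)
    (h0 : ∀ k j, k + j = n → 0 < s k j) (h1 : ∀ k j, k + j = n + 1 → 0 < s k j)
    (hs : s n 0 = 1) :
    ∃ (a : ℝ) (v : ℕ → ℝ), v 0 = 1 ∧ (∀ k ≤ n, 0 < v k) ∧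
      (∀ k ≤ n, s k (n - k) * v k * v (n - k) = a) ∧
      ∀ k, 1 ≤ k → k ≤ n → s k (n + 1 - k) * v k * v (n + 1 - k) = 1 := by
  set R : ℕ → ℝ := fun j => ∏ i ∈ Finset.range j, s (n - i) i / s (n - i) (i + 1) with hR
  have hRpos : ∀ j ≤ n, 0 < R j := fun j hj => Finset.prod_pos fun i hi => by
    have hi := Finset.mem_range.1 hi
    exact div_pos (h0 _ _ (by omega)) (h1 _ _ (by omega))
  have hRn := hRpos n le_rfl
  -- The value of `a` is forced by `v n = R n / a ^ n` and `s n 0 * v n * v 0 = a`.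
  set a : ℝ := R n ^ (((n + 1 : ℕ) : ℝ)⁻¹) with ha
  have ha0 : 0 < a := Real.rpow_pos_of_pos hRn _
  have han : a ^ (n + 1) = R n := Real.rpow_inv_natCast_pow hRn.le n.succ_ne_zero
  set v : ℕ → ℝ := fun j => R j / a ^ j with hv
  have hv0 : v 0 = 1 := by simp [hv, hR]
  have hvpos : ∀ k ≤ n, 0 < v k := fun k hk => div_pos (hRpos k hk) (pow_pos ha0 k)
  have hvn : v n = a := by
    rw [hv]
    simp only
    rw [← han, pow_succ]
    field_simp
  have hstep : ∀ j, j < n → v (j + 1) * a * s (n - j) (j + 1) = v j * s (n - j) j :=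
    fun j hj => by
      have := (h1 (n - j) (j + 1) (by omega)).ne'
      simp only [hv, hR, Finset.prod_range_succ, pow_succ]
      field_simp
  set c : ℕ → ℝ := fun k => s k (n - k) * v k * v (n - k) with hc
  -- The products along the two anti-diagonals determine each other. As both are invariant under
  -- reflection, `c k = a * d k = a * d (n + 1 - k) = c (n + 1 - k) = c (k - 1)`, so `c` is constant.
  set d : ℕ → ℝ := fun k => s k (n + 1 - k) * v k * v (n + 1 - k) with hd
  have hcd : ∀ k, 1 ≤ k → k ≤ n → a * d k = c k := fun k hk1 hkn => by
    have h := hstep (n - k) (by omega)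
    rw [show n - (n - k) = k by omega, show n - k + 1 = n + 1 - k by omega] at h
    simp only [hc, hd]
    linear_combination v k * h
  have hdsymm : ∀ k, 1 ≤ k → k ≤ n → d (n + 1 - k) = d k := fun k hk1 hkn => by
    simp only [hd]
    rw [show n + 1 - (n + 1 - k) = k by omega, hsymm]
    ring
  have hcstep : ∀ k, k < n → c (k + 1) = c k := fun k hk => by
    rw [← hcd (k + 1) (by omega) (by omega), ← hdsymm (k + 1) (by omega) (by omega),
      hcd _ (by omega) (by omega)]
    simp only [hc]
    rw [show n + 1 - (k + 1) = n - k by omega, show n - (n - k) = k by omega, hsymm]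
    ring
  have hcconst : ∀ k ≤ n, c k = c 0 := fun k => by
    induction k with
    | zero => simp
    | succ k ih => exact fun hk => (hcstep k hk).trans (ih (by omega))
  have hc0 : c 0 = a := by
    rw [← hcconst n le_rfl]
    simp [hc, hs, hv0, hvn]
  refine ⟨a, v, hv0, hvpos, fun k hk => (hcconst k hk).trans hc0, fun k hk1 hkn => ?_⟩
  have h := (hcd k hk1 hkn).trans ((hcconst k hkn).trans hc0)
  exact mul_left_cancel₀ ha0.ne' (h.trans (mul_one a).symm)

/-- The linearised leading-order system, written in the logarithmic perturbations
`x k = δ v k / v k`, has trivial kernel. -/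
theorem linearized_kernel_trivial {x : ℕ → ℂ} (hx0 : x 0 = 0)
    (hanti : ∀ k, 1 ≤ k → k ≤ n → x k + x (n + 1 - k) = 0)
    (habove : ∀ k, 1 ≤ k → k ≤ n →
      x k + x (n - k) = x (n + 1 - k) + x (k - 1)) :
    ∀ k ≤ n, x k = 0 := by
  -- `x k + x (n - k)` is independent of `k`, so `x` is an arithmetic progression.
  have hb : ∀ k ≤ n, x k + x (n - k) = x n := fun k => by
    induction k with
    | zero => simp [hx0]
    | succ k ih =>
      intro hk
      have h := habove (k + 1) (by omega) hk
      rw [show n + 1 - (k + 1) = n - k by omega, Nat.add_sub_cancel] at h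
      rw [h, add_comm, ih (by omega)]
  have hlin : ∀ k ≤ n, x k = -(k * x n) := fun k => by
    induction k with
    | zero => simp [hx0]
    | succ k ih =>
      intro hk
      have h1 := hanti (k + 1) (by omega) hk
      have h2 := hb k (by omega)
      rw [show n + 1 - (k + 1) = n - k by omega] at h1
      push_cast
      linear_combination h1 - h2 + ih (by omega)
  have hn : x n = 0 := by
    have h : ((n : ℂ) + 1) * x n = 0 := by linear_combination hlin n le_rfl
    exact (mul_eq_zero.1 h).resolve_left n.cast_add_one_ne_zero
  intro k hk
  rw [hlin k hk, hn, mul_zero, neg_zero]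

end LeadingOrder

/-! ### The rescaled system and its desingularization -/

section RescaledSystem

/-- The part of the `k`-th row of the rescaled equation which is divisible by `t`, after division
by `t`. -/
noncomputable def subleading (n : ℕ) (s : ℕ → ℕ → ℝ) (t : ℂ) (u : ℕ → ℂ) (k : ℕ) : ℂ :=
  ∑ j ∈ Finset.range (n - k + 1), (s k j : ℂ) * t ^ (n - k - j) * u j

/-- The `k`-th equation of the rescaled Dyson equation, `1 ≤ k ≤ n`. In terms of
`y k = η * t⁻¹ ^ k * u k` with `t ^ (n + 1) = η ^ 2` it reads `y k * ∑ j, s k j * y j = 1`. -/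
noncomputable def rescaledEq (n : ℕ) (s : ℕ → ℕ → ℝ) (t : ℂ) (u : ℕ → ℂ) (k : ℕ) : ℂ :=
  u k * ((s k (n + 1 - k) : ℂ) * u (n + 1 - k) + t * subleading n s t u k) - 1

/-- The rescaled system is degenerate at `t = 0`, where its rows `k` and `n + 1 - k` agree.
Here their antisymmetric part, which is divisible by `t`, is replaced by its quotient by `t`. -/
noncomputable def desingularizedEq (n : ℕ) (s : ℕ → ℕ → ℝ) (t : ℂ) (u : ℕ → ℂ) (k : ℕ) : ℂ :=
  rescaledEq n s t u k + rescaledEq n s t u (n + 1 - k) +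
    (u k * subleading n s t u k - u (n + 1 - k) * subleading n s t u (n + 1 - k))

variable {n : ℕ} {s : ℕ → ℕ → ℝ}

/-- The symmetric part of `desingularizedEq` is `2 * (A k + A (n + 1 - k))`, where `A` is
`rescaledEq`, and `t` times its antisymmetric part is `2 * (A k - A (n + 1 - k))`. -/
theorem rescaledEq_eq_zero_of_desingularizedEq (hsymm : ∀ k j, s k j = s j k) {t : ℂ} {u : ℕ → ℂ}
    (h : ∀ k, 1 ≤ k → k ≤ n → desingularizedEq n s t u k = 0) {k : ℕ} (hk : 1 ≤ k) (hkn : k ≤ n) :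
    rescaledEq n s t u k = 0 := by
  have h1 := h k hk hkn
  have h2 := h (n + 1 - k) (by omega) (by omega)
  unfold desingularizedEq at h1 h2
  rw [show n + 1 - (n + 1 - k) = k by omega] at h2
  have hdiff : rescaledEq n s t u k - rescaledEq n s t u (n + 1 - k) =
      t * (u k * subleading n s t u k - u (n + 1 - k) * subleading n s t u (n + 1 - k)) := by
    unfold rescaledEq
    rw [show n + 1 - (n + 1 - k) = k by omega, hsymm (n + 1 - k) k]
    ring
  linear_combination hdiff / 2 + (h1 + h2) / 4 + t / 4 * (h1 - h2)

theorem subleading_zero (u : ℕ → ℂ) (k : ℕ) :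
    subleading n s 0 u k = s k (n - k) * u (n - k) := by
  unfold subleading
  rw [Finset.sum_range_succ, Finset.sum_eq_zero]
  · simp
  · intro j hj
    have : n - k - j ≠ 0 := by have := Finset.mem_range.1 hj; omega
    simp [this]

/-- At `t = 0` the system `desingularizedEq` is non-degenerate: a direction in which its
derivative vanishes is zero. -/
theorem eq_zero_of_hasDerivAt_desingularizedEq {a : ℂ} (ha : a ≠ 0) {v x : ℕ → ℂ}
    (hx0 : x 0 = 0) (hv : ∀ k ≤ n, v k ≠ 0)
    (hva : ∀ k ≤ n, s k (n - k) * v k * v (n - k) = a)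
    (hv1 : ∀ k, 1 ≤ k → k ≤ n → s k (n + 1 - k) * v k * v (n + 1 - k) = 1)
    (hder : ∀ k, 1 ≤ k → k ≤ n →
      HasDerivAt (fun σ : ℂ => desingularizedEq n s 0 (fun i => v i + σ * x i) k) 0 0) :
    ∀ k ≤ n, x k = 0 := by
  have hlin : ∀ i, HasDerivAt (fun σ : ℂ => v i + σ * x i) (x i) 0 := fun i => by
    simpa using ((hasDerivAt_id (0 : ℂ)).mul_const (x i)).const_add (v i)
  have hprod : ∀ (c : ℂ) (i j : ℕ), i ≤ n → j ≤ n → HasDerivAt (fun σ : ℂ => (v i + σ * x i) *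
      (c * (v j + σ * x j))) (c * v i * v j * (x i / v i + x j / v j)) 0 := fun c i j hi hj => by
    have h1 := hv i hi
    have h2 := hv j hj
    have := (hlin i).mul ((hlin j).const_mul c)
    refine this.congr_deriv ?_
    rw [zero_mul, zero_mul, add_zero, add_zero]
    field_simp
  have key : ∀ k, 1 ≤ k → k ≤ n → 2 * (x k / v k + x (n + 1 - k) / v (n + 1 - k)) +
      a * ((x k / v k + x (n - k) / v (n - k)) -
        (x (n + 1 - k) / v (n + 1 - k) + x (k - 1) / v (k - 1))) = 0 := fun k hk1 hkn => by
    refine HasDerivAt.unique ?_ (hder k hk1 hkn)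
    have e1 := hv1 k hk1 hkn
    have e2 := hv1 (n + 1 - k) (by omega) (by omega)
    have e3 := hva k hkn
    have e4 := hva (n + 1 - k) (by omega)
    rw [show n + 1 - (n + 1 - k) = k by omega] at e2
    rw [show n - (n + 1 - k) = k - 1 by omega] at e4
    have d1 := hprod (s k (n + 1 - k)) k (n + 1 - k) hkn (by omega)
    have d2 := hprod (s (n + 1 - k) k) (n + 1 - k) k (by omega) hkn
    have d3 := hprod (s k (n - k)) k (n - k) hkn (by omega)
    have d4 := hprod (s (n + 1 - k) (k - 1)) (n + 1 - k) (k - 1) (by omega) (by omega)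
    rw [e1] at d1
    rw [e2] at d2
    rw [e3] at d3
    rw [e4] at d4
    have := ((d1.sub_const 1).add (d2.sub_const 1)).add (d3.sub d4)
    refine (this.congr_deriv ?_).congr_of_eventuallyEq (Eventually.of_forall fun σ => ?_)
    · ring
    · simp only [desingularizedEq, rescaledEq, subleading_zero, Pi.add_apply, Pi.sub_apply]
      rw [show n + 1 - (n + 1 - k) = k by omega, show n - (n + 1 - k) = k - 1 by omega]
      ring
  have hsum : ∀ k, 1 ≤ k → k ≤ n → x k / v k + x (n + 1 - k) / v (n + 1 - k) = 0 ∧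
      x k / v k + x (n - k) / v (n - k) =
        x (n + 1 - k) / v (n + 1 - k) + x (k - 1) / v (k - 1) := fun k hk1 hkn => by
    have h1 := key k hk1 hkn
    have h2 := key (n + 1 - k) (by omega) (by omega)
    rw [show n + 1 - (n + 1 - k) = k by omega, show n - (n + 1 - k) = k - 1 by omega,
      show n + 1 - k - 1 = n - k by omega] at h2
    refine ⟨by linear_combination (h1 + h2) / 4, ?_⟩
    refine sub_eq_zero.1 (mul_left_cancel₀ ha ?_)
    linear_combination (h1 - h2) / 2
  have := linearized_kernel_trivial (n := n) (x := fun k => x k / v k) (by simp [hx0])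
    (fun k h h' => (hsum k h h').1) (fun k h h' => (hsum k h h').2)
  exact fun k hk => (div_eq_zero_iff.1 (this k hk)).resolve_right (hv k hk)

/-- The sequence with `0`-th term `c`, followed by the entries of `u` and then by zeros. -/
def extendBy {n : ℕ} (c : ℂ) (u : Fin n → ℂ) : ℕ → ℂ
  | 0 => c
  | k + 1 => if h : k < n then u ⟨k, h⟩ else 0

theorem extendBy_succ (c : ℂ) (u : Fin n → ℂ) (i : Fin n) : extendBy c u (i + 1) = u i := by
  simp [extendBy]

theorem extendBy_add_smul (v w : Fin n → ℂ) (σ : ℂ) :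
    extendBy 1 (v + σ • w) = fun k => extendBy 1 v k + σ * extendBy 0 w k := by
  funext k
  cases k with
  | zero => simp [extendBy]
  | succ k => by_cases h : k < n <;> simp [extendBy, h]

theorem contDiff_extendBy (k : ℕ) :
    ContDiff ℂ 1 fun p : ℂ × (Fin n → ℂ) => extendBy 1 p.2 k := by
  cases k with
  | zero => exact contDiff_const
  | succ k =>
    by_cases h : k < n
    · simp only [extendBy, h, dif_pos]
      fun_prop
    · simp only [extendBy, h, dif_neg, not_false_eq_true]
      exact contDiff_const

theorem contDiff_desingularizedEq (k : ℕ) : ContDiff ℂ 1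
    fun p : ℂ × (Fin n → ℂ) => desingularizedEq n s p.1 (extendBy 1 p.2) k := by
  have h : ∀ k, ContDiff ℂ 1
      fun p : ℂ × (Fin n → ℂ) => subleading n s p.1 (extendBy 1 p.2) k := fun k => by
    unfold subleading
    exact ContDiff.sum fun j _ =>
      (contDiff_const.mul (contDiff_fst.pow _)).mul (contDiff_extendBy j)
  have h' : ∀ k, ContDiff ℂ 1
      fun p : ℂ × (Fin n → ℂ) => rescaledEq n s p.1 (extendBy 1 p.2) k := fun k => by
    unfold rescaledEq
    exact ((contDiff_extendBy k).mul ((contDiff_const.mul (contDiff_extendBy _)).add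
      (contDiff_fst.mul (h k)))).sub contDiff_const
  unfold desingularizedEq
  exact ((h' _).add (h' _)).add
    (((contDiff_extendBy _).mul (h _)).sub ((contDiff_extendBy _).mul (h _)))

end RescaledSystem

/-- The implicit function theorem for as many equations as unknowns, with non-degeneracy expressed
by directional derivatives. -/
theorem exists_continuous_implicit {ι : Type*} [Fintype ι] {f : ℂ × (ι → ℂ) → ι → ℂ}
    (hf : ContDiff ℂ 1 f) {v : ι → ℂ} (hfv : f (0, v) = 0)
    (hinj : ∀ w : ι → ℂ, HasDerivAt (fun σ : ℂ => f (0, v + σ • w)) 0 0 → w = 0) :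
    ∃ ψ : ℂ → ι → ℂ, ψ 0 = v ∧ ∀ᶠ t in 𝓝 0, ContinuousAt ψ t ∧ f (t, ψ t) = 0 := by
  have hinv : (fderiv ℂ f (0, v) ∘L .inr ℂ ℂ (ι → ℂ)).IsInvertible := by
    set T : (ι → ℂ) →L[ℂ] (ι → ℂ) := fderiv ℂ f (0, v) ∘L .inr ℂ ℂ (ι → ℂ) with hT
    have hTinj : Function.Injective (T : (ι → ℂ) →ₗ[ℂ] (ι → ℂ)) := by
      rw [← LinearMap.ker_eq_bot, LinearMap.ker_eq_bot']
      intro w hw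
      refine hinj w ?_
      have h1 : HasDerivAt (fun σ : ℂ => ((0 : ℂ), v + σ • w)) (0, w) 0 := by
        refine (hasDerivAt_const _ _).prodMk ?_
        simpa using ((hasDerivAt_id (0 : ℂ)).smul_const w).const_add v
      have h2 : HasFDerivAt f (fderiv ℂ f (0, v)) ((0 : ℂ), v + (0 : ℂ) • w) := by
        rw [zero_smul, add_zero]
        exact (hf.differentiable one_ne_zero _).hasFDerivAt
      have h3 := h2.comp_hasDerivAt (0 : ℂ) h1
      have h4 : fderiv ℂ f (0, v) (0, w) = 0 := hw
      rwa [h4] at h3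
    exact ⟨(LinearEquiv.ofInjectiveEndo (T : (ι → ℂ) →ₗ[ℂ] (ι → ℂ))
      hTinj).toContinuousLinearEquiv, by ext; rfl⟩
  have hc : ContDiffAt ℂ 1 f (0, v) := hf.contDiffAt
  refine ⟨hc.implicitFunction one_ne_zero hinv, hc.implicitFunction_apply_self _ hinv, ?_⟩
  have hψ := hc.contDiffAt_implicitFunction one_ne_zero hinv
  filter_upwards [hψ.eventually (by simp), hc.eventually_apply_implicitFunction one_ne_zero hinv]
    with t h1 h2
  exact ⟨h1.continuousAt, h2.trans hfv⟩

/-- The rescaled system has a solution `u t` that is continuous near `t = 0` and whose value at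
`t = 0` is the vector of leading coefficients. -/
theorem exists_rescaled_solution {n : ℕ} {s : ℕ → ℕ → ℝ} (hsymm : ∀ k j, s k j = s j k)
    (h0 : ∀ k j, k + j = n → 0 < s k j) (h1 : ∀ k j, k + j = n + 1 → 0 < s k j)
    (hs : s n 0 = 1) :
    ∃ (v : ℕ → ℝ) (u : ℂ → ℕ → ℂ), (∀ k ≤ n, 0 < v k) ∧ (∀ k ≤ n, u 0 k = v k) ∧
      (∀ t, u t 0 = 1) ∧ ∀ᶠ t in 𝓝 0, (∀ k, ContinuousAt (fun t => u t k) t) ∧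
        ∀ k, 1 ≤ k → k ≤ n → rescaledEq n s t (u t) k = 0 := by
  obtain ⟨a, v, hv0, hvpos, hva, hv1⟩ := exists_leading_coefficients hsymm h0 h1 hs
  set V : Fin n → ℂ := fun i => v (i + 1) with hV
  have hext : ∀ k ≤ n, extendBy 1 V k = v k := fun k hk => by
    cases k with
    | zero => simp [extendBy, hv0]
    | succ k => simp [extendBy, hV, Nat.lt_of_succ_le hk]
  have hva' : ∀ k ≤ n, (s k (n - k) : ℂ) * extendBy 1 V k * extendBy 1 V (n - k) = a :=
    fun k hk => by
      rw [hext k hk, hext _ (Nat.sub_le n k)]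
      exact_mod_cast hva k hk
  have hv1' : ∀ k, 1 ≤ k → k ≤ n →
      (s k (n + 1 - k) : ℂ) * extendBy 1 V k * extendBy 1 V (n + 1 - k) = 1 := fun k hk hk' => by
    rw [hext k hk', hext _ (by omega)]
    exact_mod_cast hv1 k hk hk'
  have hvne : ∀ k ≤ n, extendBy 1 V k ≠ 0 := fun k hk => by
    rw [hext k hk]
    exact_mod_cast (hvpos k hk).ne'
  have ha : (a : ℂ) ≠ 0 := by
    rw [← hva' 0 n.zero_le]
    have := (h0 0 n (by omega)).ne'
    exact mul_ne_zero (mul_ne_zero (by exact_mod_cast this) (hvne _ n.zero_le))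
      (hvne _ (Nat.sub_le _ _))
  obtain ⟨ψ, hψ0, hψ⟩ := exists_continuous_implicit (ι := Fin n)
    (f := fun p i => desingularizedEq n s p.1 (extendBy 1 p.2) (i + 1)) (v := V)
    (contDiff_pi.2 fun i => contDiff_desingularizedEq _)
    (by
      funext i
      have e1 := hv1' (i + 1) (by omega) (by omega)
      have e2 := hv1' (n + 1 - (i + 1)) (by omega) (by omega)
      have e3 := hva' (i + 1) (by omega)
      have e4 := hva' (n + 1 - (i + 1)) (by omega)
      simp only [desingularizedEq, rescaledEq, subleading_zero, Pi.zero_apply]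
      linear_combination e1 + e2 + e3 - e4)
    (fun w hw => by
      have hx := eq_zero_of_hasDerivAt_desingularizedEq (n := n) (s := s) ha
        (v := extendBy 1 V) (x := extendBy 0 w) rfl hvne hva' hv1' (fun k hk hkn => by
          have := hasDerivAt_pi.1 hw ⟨k - 1, by omega⟩
          simp only [extendBy_add_smul, Pi.zero_apply, Nat.sub_add_cancel hk] at this
          exact this)
      funext i
      rw [← extendBy_succ 0 w i]
      exact hx (i + 1) i.isLt)
  refine ⟨v, fun t => extendBy 1 (ψ t), hvpos, fun k hk => by simp only [hψ0, hext k hk],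
    fun t => rfl, ?_⟩
  filter_upwards [hψ] with t ht
  refine ⟨fun k => ?_, fun k hk hkn => rescaledEq_eq_zero_of_desingularizedEq hsymm
    (fun k hk hkn => ?_) hk hkn⟩
  · exact (contDiff_extendBy (n := n) k).continuous.continuousAt.comp
      (continuousAt_id.prodMk ht.1)
  · have := congrFun ht.2 ⟨k - 1, by omega⟩
    simpa only [Nat.sub_add_cancel hk, Pi.zero_apply] using this

/-! ### The solution near the origin -/

section LocalSolution

variable {n : ℕ} {S : Matrix (Fin n) (Fin n) ℝ}

/-- The matrix `S` with 1-based indices, bordered by a row and a column of ones with index `0`: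
these carry the spectral parameter, which becomes the `0`-th unknown. -/
def borderedMatrix (S : Matrix (Fin n) (Fin n) ℝ) : ℕ → ℕ → ℝ
  | 0, _ => 1
  | _ + 1, 0 => 1
  | i + 1, j + 1 => if h : i < n ∧ j < n then S ⟨i, h.1⟩ ⟨j, h.2⟩ else 0

theorem borderedMatrix_zero_right (S : Matrix (Fin n) (Fin n) ℝ) (k : ℕ) :
    borderedMatrix S k 0 = 1 := by
  cases k <;> rfl

theorem borderedMatrix_succ_succ (S : Matrix (Fin n) (Fin n) ℝ) (i j : Fin n) :
    borderedMatrix S (i + 1) (j + 1) = S i j := by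
  simp [borderedMatrix]

theorem borderedMatrix_symm (hS : S.IsSymm) (k j : ℕ) :
    borderedMatrix S k j = borderedMatrix S j k := by
  cases k <;> cases j <;> simp only [borderedMatrix]
  rename_i k j
  by_cases h : k < n ∧ j < n
  · rw [dif_pos h, dif_pos h.symm, hS.apply]
  · rw [dif_neg h, dif_neg fun h' => h h'.symm]

theorem borderedMatrix_pos (hS : IsStaircase S) {k j : ℕ} (h : k + j = n ∨ k + j = n + 1) :
    0 < borderedMatrix S k j := by
  cases k <;> cases j <;> simp only [borderedMatrix, zero_lt_one]
  rw [dif_pos (by omega)]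
  rcases h with h | h
  · exact hS.pos_above _ _ (by simp only; omega)
  · exact hS.pos_anti _ _ (by simp only; omega)

theorem borderedMatrix_eq_zero (hS : IsStaircase S) {k j : ℕ} (hk : 1 ≤ k) (hj : 1 ≤ j)
    (h : n + 1 < k + j) : borderedMatrix S k j = 0 := by
  obtain ⟨k, rfl⟩ := Nat.exists_eq_add_of_le' hk
  obtain ⟨j, rfl⟩ := Nat.exists_eq_add_of_le' hj
  simp only [borderedMatrix]
  split_ifs
  · exact hS.zero_below _ _ (by simp only; omega)
  · rfl

/-- A zero `u` of the rescaled system gives a solution of the Dyson equation in the form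
`y k * (η + ∑ j, S k j * y j) = 1`, where `η = -I * z` and `y = -I * m`. -/
theorem mul_dyson_sum_eq_one (hS : IsStaircase S) {η t : ℂ} (ht : t ≠ 0)
    (htη : t ^ (n + 1) = η ^ 2) {u : ℕ → ℂ} (hu0 : u 0 = 1) (i : Fin n)
    (hu : rescaledEq n (borderedMatrix S) t u (i + 1) = 0) :
    η * t⁻¹ ^ ((i : ℕ) + 1) * u (i + 1) *
      (η + ∑ j : Fin n, (S i j : ℂ) * (η * t⁻¹ ^ ((j : ℕ) + 1) * u (j + 1))) = 1 := by
  set k : ℕ := i + 1 with hk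
  have hkn : k ≤ n := i.isLt
  have e1 : η + ∑ j : Fin n, (S i j : ℂ) * (η * t⁻¹ ^ ((j : ℕ) + 1) * u (j + 1)) =
      ∑ j ∈ Finset.range (n + 1), (borderedMatrix S k j : ℂ) * (η * t⁻¹ ^ j * u j) := by
    rw [Finset.sum_range_succ', borderedMatrix_zero_right, hu0,
      ← Fin.sum_univ_eq_sum_range
        (fun j => (borderedMatrix S k (j + 1) : ℂ) * (η * t⁻¹ ^ (j + 1) * u (j + 1)))]
    simp only [hk, borderedMatrix_succ_succ]
    simp [add_comm]
  have e2 : ∑ j ∈ Finset.range (n + 1), (borderedMatrix S k j : ℂ) * (η * t⁻¹ ^ j * u j) =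
      ∑ j ∈ Finset.range (n - k + 1 + 1),
        (borderedMatrix S k j : ℂ) * (η * t⁻¹ ^ j * u j) := by
    symm
    refine Finset.sum_subset (Finset.range_subset_range.2 (by omega)) fun j hj hj' => ?_
    rw [Finset.mem_range] at hj hj'
    rw [borderedMatrix_eq_zero hS (by omega) (by omega) (by omega)]
    simp
  have e3 : t ^ (n + 1 - k) * ∑ j ∈ Finset.range (n - k + 1 + 1),
      (borderedMatrix S k j : ℂ) * (η * t⁻¹ ^ j * u j) =
      η * ((borderedMatrix S k (n + 1 - k) : ℂ) * u (n + 1 - k) +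
        t * subleading n (borderedMatrix S) t u k) := by
    have hpow : ∀ j ≤ n + 1 - k, t ^ (n + 1 - k) * t⁻¹ ^ j = t ^ (n + 1 - k - j) :=
      fun j hj => by
        rw [inv_pow, pow_sub₀ t ht hj]
    rw [Finset.sum_range_succ, mul_add, show n - k + 1 = n + 1 - k by omega, mul_add η,
      add_comm]
    congr 1
    · have := hpow (n + 1 - k) le_rfl
      rw [Nat.sub_self, pow_zero] at this
      linear_combination (borderedMatrix S k (n + 1 - k) : ℂ) * η * u (n + 1 - k) * this
    · unfold subleading
      rw [show n - k + 1 = n + 1 - k by omega, Finset.mul_sum, Finset.mul_sum, Finset.mul_sum]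
      refine Finset.sum_congr rfl fun j hj => ?_
      have hj := Finset.mem_range.1 hj
      have h := hpow j hj.le
      rw [show n + 1 - k - j = (n - k - j) + 1 by omega, pow_succ] at h
      linear_combination (borderedMatrix S k j : ℂ) * η * u j * h
  rw [e1, e2]
  have ht1 : t ^ (n + 1 - k) ≠ 0 := pow_ne_zero _ ht
  have ht2 : t ^ k * t ^ (n + 1 - k) = η ^ 2 := by
    rw [← pow_add, show k + (n + 1 - k) = n + 1 by omega, htη]
  have ht3 : t⁻¹ ^ k * t ^ k = 1 := by rw [← mul_pow, inv_mul_cancel₀ ht, one_pow]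
  unfold rescaledEq at hu
  refine mul_left_cancel₀ ht1 ?_
  linear_combination (η * t⁻¹ ^ k * u k) * e3 + η ^ 2 * t⁻¹ ^ k * hu
    - t⁻¹ ^ k * ht2 + t ^ (n + 1 - k) * ht3

/-- The exponent of the entry with 0-based index `i` of the solution at the origin. -/
noncomputable def vdeExponent (n : ℕ) (i : ℕ) : ℝ := 1 - 2 * (i + 1) / (n + 1)

theorem abs_vdeExponent_le {i : ℕ} (hi : i < n) :
    |vdeExponent n i| ≤ ((n : ℝ) - 1) / (n + 1) := by
  have h1 : ((i : ℝ) + 1) ≤ n := by exact_mod_cast hi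
  have h2 : (0 : ℝ) ≤ i := i.cast_nonneg
  have h3 : (0 : ℝ) < n + 1 := by positivity
  have : vdeExponent n i = ((n : ℝ) + 1 - 2 * (i + 1)) / (n + 1) := by
    unfold vdeExponent
    field_simp
  rw [this, abs_div, abs_of_pos h3]
  gcongr
  rw [abs_le]
  constructor <;> linarith

theorem half_pi_mul_lt (n : ℕ) (hn : 1 ≤ n) :
    0 ≤ ((n : ℝ) - 1) / (n + 1) ∧
      Real.pi / 2 * (((n : ℝ) - 1) / (n + 1)) < Real.pi / 2 := by
  have h1 : (1 : ℝ) ≤ n := by exact_mod_cast hn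
  have h2 : ((n : ℝ) - 1) / (n + 1) < 1 := by
    rw [div_lt_one (by positivity)]
    linarith
  refine ⟨div_nonneg (by linarith) (by linarith), ?_⟩
  have := Real.pi_pos
  nlinarith

/-- On the right half-plane `η ^ e` with `|e| ≤ p < 1` stays in the sector of half-opening
`π p / 2`, so multiplying by a number sufficiently close to a positive one keeps the real part
positive. -/
theorem cpow_mul_re_pos {η w : ℂ} {e p v : ℝ} (hη : 0 < η.re) (he : |e| ≤ p)
    (hp : Real.pi / 2 * p ≤ Real.pi) (hv : 0 < v)
    (hw : ‖w - v‖ < Real.cos (Real.pi / 2 * p) * v) : 0 < (η ^ (e : ℂ) * w).re := by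
  have hη0 : η ≠ 0 := fun h => by simp [h] at hη
  have hpos : 0 < ‖η‖ ^ e := Real.rpow_pos_of_pos (norm_pos_iff.2 hη0) e
  have hcos : Real.cos (Real.pi / 2 * p) ≤ Real.cos (η.arg * e) := by
    rw [← Real.cos_abs (η.arg * e), abs_mul]
    refine Real.cos_le_cos_of_nonneg_of_le_pi (by positivity) hp ?_
    exact mul_le_mul (Complex.abs_arg_le_pi_div_two_iff.2 hη.le) he (abs_nonneg _)
      Real.pi_div_two_pos.le
  have h1 : (η ^ (e : ℂ) * w).re =
      ‖η‖ ^ e * Real.cos (η.arg * e) * v + (η ^ (e : ℂ) * (w - v)).re := by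
    rw [← Complex.cpow_ofReal_re, ← Complex.re_mul_ofReal, ← Complex.add_re]
    ring_nf
  have h2 : -(‖η‖ ^ e * ‖w - v‖) ≤ (η ^ (e : ℂ) * (w - v)).re := by
    rw [← Complex.norm_cpow_real η e, ← norm_mul]
    exact (abs_le.1 (Complex.abs_re_le_norm _)).1
  rw [h1]
  have h3 : ‖η‖ ^ e * ‖w - v‖ < ‖η‖ ^ e * (Real.cos (η.arg * e) * v) :=
    mul_lt_mul_of_pos_left (hw.trans_le (mul_le_mul_of_nonneg_right hcos hv.le)) hpos
  nlinarith

/-- Near the origin every solution of the vector Dyson equation is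
`I * (-I z) ^ (vdeExponent n i) * W z i`, where `W` extends continuously to the real axis, including
the origin, where its value is positive. -/
theorem exists_local_solution (hn : 1 ≤ n) (hS : IsStaircase S) :
    ∃ (v : Fin n → ℝ) (W : ℂ → Fin n → ℂ), (∀ i, 0 < v i) ∧
      (∀ i, Tendsto (fun ζ => W ζ i) (𝓝 0) (𝓝 (v i : ℂ))) ∧
      ∀ᶠ ζ in 𝓝 (0 : ℂ),
        (∀ i, ζ ≠ 0 → 0 ≤ ζ.im → ContinuousAt (fun ζ => W ζ i) ζ) ∧
        ∀ m, IsVDESolution S m → ∀ z : ℍ, (z : ℂ) = ζ → ∀ i, (m z i : ℂ) =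
          Complex.I * ((-Complex.I * ζ) ^ (vdeExponent n i : ℂ) * W ζ i) := by
  obtain ⟨v, u, hv, huv, hu0, hu⟩ := exists_rescaled_solution (borderedMatrix_symm hS.symm)
    (fun k j h => borderedMatrix_pos hS (Or.inl h)) (fun k j h => borderedMatrix_pos hS (Or.inr h))
    (borderedMatrix_zero_right S n)
  set τ : ℂ := 2 / (n + 1) with hτ
  have hn0 : (n : ℂ) + 1 ≠ 0 := n.cast_add_one_ne_zero
  have hτre : 0 < τ.re := by
    have : τ = ((2 / (n + 1) : ℝ) : ℂ) := by rw [hτ]; push_cast; rfl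
    rw [this, Complex.ofReal_re]
    positivity
  have hτ0 : τ ≠ 0 := fun h => by simp [h] at hτre
  set T : ℂ → ℂ := fun ζ => (-Complex.I * ζ) ^ τ with hT
  have hT0 : Tendsto T (𝓝 0) (𝓝 0) := by
    have h : ContinuousAt T 0 := by
      refine ContinuousAt.comp (g := fun x : ℂ => x ^ τ) ?_
        (continuous_const.mul continuous_id).continuousAt
      exact Complex.continuousAt_cpow_const_of_re_pos (by simp) hτre
    have := h.tendsto
    simpa [hT, Complex.zero_cpow hτ0] using this
  have huT : ∀ k ≤ n, Tendsto (fun ζ => u (T ζ) k) (𝓝 0) (𝓝 (v k : ℂ)) := fun k hk => by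
    have h := (hu.self_of_nhds.1 k).tendsto
    rw [huv k hk] at h
    exact h.comp hT0
  refine ⟨fun i => v (i + 1), fun ζ i => u (T ζ) (i + 1), fun i => hv _ i.isLt,
    fun i => huT _ i.isLt, ?_⟩
  obtain ⟨hp0, hp1⟩ := half_pi_mul_lt n hn
  have hcos : 0 < Real.cos (Real.pi / 2 * (((n : ℝ) - 1) / (n + 1))) :=
    Real.cos_pos_of_mem_Ioo ⟨by have := Real.pi_pos; nlinarith, hp1⟩
  have hclose : ∀ᶠ ζ in 𝓝 (0 : ℂ), ∀ i : Fin n, ‖u (T ζ) (i + 1) - v (i + 1)‖ <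
      Real.cos (Real.pi / 2 * (((n : ℝ) - 1) / (n + 1))) * v (i + 1) :=
    eventually_all.2 fun i => by
      have := (tendsto_iff_norm_sub_tendsto_zero.1 (huT (i + 1) i.isLt))
      exact this.eventually_lt_const (mul_pos hcos (hv _ i.isLt))
  filter_upwards [hT0.eventually hu, hclose] with ζ hζ hζclose
  refine ⟨fun i hζ0 hζim => ?_, fun m hm z hz i => ?_⟩
  · refine ContinuousAt.comp (g := fun t => u t (i + 1)) (f := T) (hζ.1 _) ?_
    refine ContinuousAt.comp (g := fun x : ℂ => x ^ τ) ?_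
      (continuous_const.mul continuous_id).continuousAt
    refine Complex.continuousAt_cpow_const_of_re_pos ?_ hτre
    simp only [neg_mul, Complex.neg_re, Complex.I_mul_re, neg_neg, Complex.neg_im,
      Complex.I_mul_im]
    exact Or.inl hζim
  · set η : ℂ := -Complex.I * ζ with hη
    have hηre : 0 < η.re := by
      simpa [hη, ← hz] using z.im_pos
    have hη0 : η ≠ 0 := fun h => by simp [h] at hηre
    have hTζ : T ζ = η ^ τ := rfl
    have ht0 : T ζ ≠ 0 := by
      rw [hTζ, Complex.cpow_ne_zero_iff]
      exact Or.inl hη0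
    have htη : T ζ ^ (n + 1) = η ^ 2 := by
      rw [hTζ, ← Complex.cpow_nat_mul, ← Complex.cpow_natCast, hτ]
      congr 1
      push_cast
      field_simp
    have hpow : ∀ j : ℕ, η ^ (vdeExponent n j : ℂ) = η * (T ζ)⁻¹ ^ (j + 1) := fun j => by
      have : (vdeExponent n j : ℂ) = 1 - ((j + 1 : ℕ) : ℂ) * τ := by
        rw [vdeExponent, hτ]
        push_cast
        ring
      rw [this, Complex.cpow_sub _ _ hη0, Complex.cpow_one, Complex.cpow_nat_mul, inv_pow, hTζ,
        div_eq_mul_inv]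
    let y : Fin n → ℂ := fun j => η ^ (vdeExponent n j : ℂ) * u (T ζ) (j + 1)
    have hypos : ∀ j, 0 < (y j).re := fun j => by
      have hpi := Real.pi_pos
      exact cpow_mul_re_pos hηre (abs_vdeExponent_le j.isLt) (by linarith) (hv _ j.isLt)
        (hζclose j)
    have hy : ∀ j, y j * (η + ∑ l, (S j l : ℂ) * y l) = 1 := fun j => by
      have := mul_dyson_sum_eq_one hS ht0 htη (hu0 _) j (hζ.2 _ (by omega) j.isLt)
      simpa only [y, hpow] using this
    let b : Fin n → ℍ := fun j => ⟨Complex.I * y j, by simpa using hypos j⟩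
    -- `I * y` lies in `ℍ ^ n` and solves the equation, so it is the solution by uniqueness.
    have hb : dysonMap S hS.nonneg z b = b := by
      rw [dysonMap_eq_self_iff]
      intro j
      have hyj : y j ≠ 0 := fun h => by simpa [h] using hypos j
      have hzη : (z : ℂ) = Complex.I * η := by
        rw [hz, hη, ← mul_assoc, mul_neg, Complex.I_mul_I, neg_neg, one_mul]
      have hsum : ∑ l, (S j l : ℂ) * (b l : ℂ) = Complex.I * ∑ l, (S j l : ℂ) * y l := by
        rw [Finset.mul_sum]
        exact Finset.sum_congr rfl fun l _ => by simp only [b]; ring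
      rw [hsum, hzη, ← mul_add]
      have hbj : (b j : ℂ) = Complex.I * y j := rfl
      rw [hbj, div_eq_iff (mul_ne_zero Complex.I_ne_zero hyj)]
      linear_combination (-(Complex.I ^ 2)) * hy j - Complex.I_sq
    have := dysonMap_fixedPoint_unique hS.nonneg z
      ((dysonMap_eq_self_iff hS.nonneg).2 (hm z)) hb
    rw [this]

end LocalSolution

/-! ### The density of states -/

section Density

variable {n : ℕ} {S : Matrix (Fin n) (Fin n) ℝ}

theorem norm_neg_I_mul_ofReal (E : ℝ) : ‖-Complex.I * (E : ℂ)‖ = |E| := by simp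

theorem abs_arg_neg_I_mul_ofReal {E : ℝ} (hE : E ≠ 0) :
    |(-Complex.I * (E : ℂ)).arg| = Real.pi / 2 := by
  refine le_antisymm (Complex.abs_arg_le_pi_div_two_iff.2 (by simp)) (not_lt.1 fun h => ?_)
  rcases Complex.abs_arg_lt_pi_div_two_iff.1 h with h | h
  · simp at h
  · simp [hE] at h

/-- If `w E → v` as `E → 0` then `Re ((-I E) ^ e * w E)` is asymptotic to
`cos (π e / 2) * v * |E| ^ e`, from both sides. -/
theorem tendsto_cpow_mul_re {w : ℂ → ℂ} {v e p : ℝ} (hw : Tendsto w (𝓝 0) (𝓝 (v : ℂ)))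
    (hep : 0 ≤ e + p) :
    Tendsto (fun E : ℝ => ((-Complex.I * (E : ℂ)) ^ (e : ℂ) * w E).re * |E| ^ p) (𝓝[≠] 0)
      (𝓝 (if e + p = 0 then Real.cos (Real.pi / 2 * e) * v else 0)) := by
  have hE : Tendsto (fun E : ℝ => (E : ℂ)) (𝓝[≠] 0) (𝓝 0) :=
    (Complex.continuous_ofReal.tendsto' 0 0 Complex.ofReal_zero).mono_left nhdsWithin_le_nhds
  have hwE := hw.comp hE
  have hre : Tendsto (fun E : ℝ => (w E).re) (𝓝[≠] 0) (𝓝 v) :=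
    (Complex.continuous_re.tendsto _).comp hwE
  have him : Tendsto (fun E : ℝ => (w E).im) (𝓝[≠] 0) (𝓝 0) :=
    (Complex.continuous_im.tendsto _).comp hwE
  have hsin : Tendsto (fun E : ℝ => Real.sin ((-Complex.I * (E : ℂ)).arg * e) * (w E).im)
      (𝓝[≠] 0) (𝓝 0) :=
    bdd_le_mul_tendsto_zero' 1 (Eventually.of_forall fun E => Real.abs_sin_le_one _) him
  have hmain : Tendsto (fun E : ℝ => |E| ^ (e + p) * (Real.cos (Real.pi / 2 * e) * (w E).re -
      Real.sin ((-Complex.I * (E : ℂ)).arg * e) * (w E).im)) (𝓝[≠] 0)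
      (𝓝 ((if e + p = 0 then 1 else 0) * (Real.cos (Real.pi / 2 * e) * v - 0))) := by
    refine Tendsto.mul ?_ ((hre.const_mul _).sub hsin)
    split_ifs with h
    · simp [h]
    · have hpos : 0 < e + p := lt_of_le_of_ne hep (Ne.symm h)
      have h1 : Tendsto (fun E : ℝ => |E|) (𝓝[≠] 0) (𝓝 0) :=
        (continuous_abs.tendsto' 0 0 abs_zero).mono_left nhdsWithin_le_nhds
      have h2 := (Real.continuousAt_rpow_const 0 (e + p) (Or.inr hep)).tendsto
      rw [Real.zero_rpow h] at h2
      exact h2.comp h1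
  have hlim : (if e + p = 0 then (1 : ℝ) else 0) * (Real.cos (Real.pi / 2 * e) * v - 0) =
      if e + p = 0 then Real.cos (Real.pi / 2 * e) * v else 0 := by
    split_ifs <;> simp
  rw [hlim] at hmain
  refine hmain.congr' ?_
  filter_upwards [self_mem_nhdsWithin] with E hE0
  have hcos : Real.cos ((-Complex.I * (E : ℂ)).arg * e) = Real.cos (Real.pi / 2 * e) := by
    rw [← Real.cos_abs, abs_mul, abs_arg_neg_I_mul_ofReal hE0,
      ← Real.cos_abs (Real.pi / 2 * e), abs_mul, abs_of_pos Real.pi_div_two_pos]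
  have hcim : ((-Complex.I * (E : ℂ)) ^ (e : ℂ)).im =
      |E| ^ e * Real.sin ((-Complex.I * (E : ℂ)).arg * e) := by
    rw [Complex.cpow_ofReal_im, norm_neg_I_mul_ofReal]
  rw [Complex.mul_re, Complex.cpow_ofReal_re, hcim, norm_neg_I_mul_ofReal, hcos,
    Real.rpow_add (abs_pos.2 hE0)]
  ring

theorem tendsto_smoothedDOS {m : ℍ → Fin n → ℍ} {W : ℂ → Fin n → ℂ} {E : ℝ} (hE : E ≠ 0)
    (hW : ∀ i, ContinuousAt (fun ζ => W ζ i) E)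
    (hm : ∀ᶠ ζ in 𝓝 (E : ℂ), ∀ z : ℍ, (z : ℂ) = ζ → ∀ i, (m z i : ℂ) =
      Complex.I * ((-Complex.I * ζ) ^ (vdeExponent n i : ℂ) * W ζ i)) :
    Tendsto (fun η : ℝ => smoothedDOS m E η) (𝓝[>] 0) (𝓝 (1 / (Real.pi * n) *
      ∑ i : Fin n, ((-Complex.I * (E : ℂ)) ^ (vdeExponent n i : ℂ) * W E i).re)) := by
  have hζ : Tendsto (fun η : ℝ => (E : ℂ) + η * Complex.I) (𝓝[>] 0) (𝓝 (E : ℂ)) := by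
    have h : Continuous fun η : ℝ => (E : ℂ) + η * Complex.I := by fun_prop
    exact (h.tendsto' 0 _ (by simp)).mono_left nhdsWithin_le_nhds
  have hcont : ∀ i : Fin n, Tendsto
      (fun ζ : ℂ => ((-Complex.I * ζ) ^ (vdeExponent n i : ℂ) * W ζ i).re) (𝓝 (E : ℂ))
      (𝓝 ((-Complex.I * (E : ℂ)) ^ (vdeExponent n i : ℂ) * W E i).re) := fun i => by
    have h1 : ContinuousAt (fun ζ : ℂ => -Complex.I * ζ) (E : ℂ) :=
      (continuous_const.mul continuous_id).continuousAt
    have h2 : -Complex.I * (E : ℂ) ∈ Complex.slitPlane :=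
      Complex.mem_slitPlane_iff.2 (Or.inr (by simpa using hE))
    have h3 : ContinuousAt (fun ζ : ℂ => (-Complex.I * ζ) ^ (vdeExponent n i : ℂ)) (E : ℂ) :=
      h1.cpow continuousAt_const h2
    exact (Complex.continuous_re.tendsto _).comp (h3.mul (hW i)).tendsto
  refine ((tendsto_finsetSum _ fun i _ => (hcont i).comp hζ).const_mul _).congr' ?_
  filter_upwards [self_mem_nhdsWithin, hζ.eventually hm] with η hη h
  have him : 0 < ((E : ℂ) + η * Complex.I).im := by simpa using hη
  have hz := UpperHalfPlane.ofComplex_apply_of_im_pos him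
  unfold smoothedDOS
  congr 1
  refine Finset.sum_congr rfl fun i _ => ?_
  rw [← UpperHalfPlane.coe_im, h _ (by rw [hz]) i, Complex.I_mul_im]
  rfl

end Density

theorem corollary1p4 (n : ℕ) (hn : 1 ≤ n) (S : Matrix (Fin n) (Fin n) ℝ) (hS : IsStaircase S) :
    (∃! m : ℍ → Fin n → ℍ, IsVDESolution S m) ∧
    ∀ m : ℍ → Fin n → ℍ, IsVDESolution S m →
      (∀ᶠ E : ℝ in 𝓝[≠] 0,
        Tendsto (fun η : ℝ => smoothedDOS m E η) (𝓝[>] 0) (𝓝 (selfConsistentDOS m E))) ∧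
      ∃ c : ℝ, 0 < c ∧
        Tendsto (fun E : ℝ => selfConsistentDOS m E * |E| ^ (((n : ℝ) - 1) / ((n : ℝ) + 1)))
          (𝓝[≠] 0) (𝓝 c) := by
  refine ⟨existsUnique_isVDESolution hS.nonneg, fun m hm => ?_⟩
  obtain ⟨v, W, hv, hWv, hloc⟩ := exists_local_solution hn hS
  have hEC : Tendsto (fun E : ℝ => (E : ℂ)) (𝓝[≠] 0) (𝓝 0) :=
    (Complex.continuous_ofReal.tendsto' 0 0 Complex.ofReal_zero).mono_left nhdsWithin_le_nhds
  have hlim : ∀ᶠ E : ℝ in 𝓝[≠] 0, Tendsto (fun η : ℝ => smoothedDOS m E η) (𝓝[>] 0)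
      (𝓝 (1 / (Real.pi * n) * ∑ i : Fin n,
        ((-Complex.I * (E : ℂ)) ^ (vdeExponent n i : ℂ) * W E i).re)) := by
    filter_upwards [self_mem_nhdsWithin, hEC.eventually hloc.eventually_nhds] with E hE0 hE
    exact tendsto_smoothedDOS hE0
      (fun i => hE.self_of_nhds.1 i (Complex.ofReal_ne_zero.2 hE0) (by simp))
      (hE.mono fun ζ hζ => hζ.2 m hm)
  refine ⟨hlim.mono fun E hE => by rwa [selfConsistentDOS, hE.limUnder_eq], ?_⟩
  set p : ℝ := ((n : ℝ) - 1) / (n + 1) with hp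
  obtain ⟨hp0, hp1⟩ := half_pi_mul_lt n hn
  set L : Fin n → ℝ := fun i => if vdeExponent n i + p = 0 then
    Real.cos (Real.pi / 2 * vdeExponent n i) * v i else 0 with hL
  have hcos : 0 < Real.cos (Real.pi / 2 * p) :=
    Real.cos_pos_of_mem_Ioo ⟨by have := Real.pi_pos; nlinarith, hp1⟩
  have hLval : ∀ i : Fin n, vdeExponent n i + p = 0 → L i = Real.cos (Real.pi / 2 * p) * v i :=
    fun i hi => by
      rw [hL]
      simp only
      rw [if_pos hi, eq_neg_of_add_eq_zero_left hi, mul_neg, Real.cos_neg]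
  have hLnonneg : ∀ i, 0 ≤ L i := fun i => by
    by_cases h : vdeExponent n i + p = 0
    · rw [hLval i h]
      exact (mul_pos hcos (hv i)).le
    · simp [hL, h]
  -- Only the last entry of the solution contributes at leading order.
  have hlast : vdeExponent n (n - 1) + p = 0 := by
    rw [vdeExponent, hp, Nat.cast_sub hn]
    have : (n : ℝ) + 1 ≠ 0 := n.cast_add_one_ne_zero
    field_simp
    push_cast
    ring
  have hLsum : 0 < ∑ i, L i := by
    refine Finset.sum_pos' (fun i _ => hLnonneg i) ⟨⟨n - 1, by omega⟩, Finset.mem_univ _, ?_⟩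
    rw [hLval ⟨n - 1, _⟩ hlast]
    exact mul_pos hcos (hv _)
  have hn' : (0 : ℝ) < n := by exact_mod_cast hn
  refine ⟨1 / (Real.pi * n) * ∑ i, L i, by have := Real.pi_pos; positivity, ?_⟩
  have hterm : ∀ i : Fin n, Tendsto (fun E : ℝ =>
      ((-Complex.I * (E : ℂ)) ^ (vdeExponent n i : ℂ) * W E i).re * |E| ^ p) (𝓝[≠] 0)
      (𝓝 (L i)) := fun i => tendsto_cpow_mul_re (w := fun ζ => W ζ i) (hWv i) (by
    have := (abs_le.1 (abs_vdeExponent_le i.isLt)).1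
    rw [← hp] at this
    linarith)
  refine ((tendsto_finsetSum Finset.univ fun i _ => hterm i).const_mul _).congr' ?_
  filter_upwards [hlim] with E hE
  rw [selfConsistentDOS, hE.limUnder_eq, ← Finset.sum_mul]
  ring
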